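/- Let $M$ be a two-dimensional smooth manifold with a Riemannian metric $\alpha=\sqrt{a_{ij}(x)y^iy^j}$ and a smooth $1$-form $\beta=b_i(x)y^i$, and let $b(x)=\|\beta_x\|_\alpha=\sup_{y\neq 0}|\beta_x(y)|/\alpha(x,y)$. Let $k_1<k_2$ be real constants, fix a sign $\pm$, and let $F=\alpha\,\phi(\beta/\alpha)$ with $$\phi(s)=\big\{(1+k_1s^2)(1+k_2s^2)\big\}^{1/4}\exp\Big(\int_0^s\tau(t)\,dt\Big),\qquad \tau(t)=\frac{\pm\sqrt{k_2-k_1}}{2(1+k_1t^2)\sqrt{1+k_2t^2}}.$$ Say that $F$ is positive definite on $TM\setminus 0$ if $F$ is $C^\infty$ and positive on $TM\setminus 0$, $F(x,cy)=cF(x,y)$ for $c>0$, and for all $x\in M$ and $y\in T_xM\setminus\{0\}$ the fundamental tensor $$g_y(u,v)=\tfrac12\,\frac{\partial^2}{\partial s\,\partial t}\Big|_{s=t=0}F^2(x,y+su+tv)$$ is positive definite on $T_xM$. Then $F$ is positive definite on $TM\setminus0$ if and only if $$1+k_1\,b(x)^2>0\quad\text{for all }x\in M .$$ Moreover, if this condition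 holds, then at every value $s=\beta(y)/\alpha(y)$, $y\in TM\setminus0$, the formula for $\phi(s)$ is well defined: for all $t$ between $0$ and $s$ one has $1+k_1t^2\neq0$ and $1+k_2t^2>0$, and $(1+k_1s^2)(1+k_2s^2)\ge0$. (In the equivalence, where roots of negative numbers or a divergent integral would occur in $\phi$, they are given conventional real values; then $\phi(s)=0$ wherever $1+k_1s^2=0$.) -/

import Mathlib

open scoped Manifold ContDiff Bundle

noncomputable section

/-- The integrand `τ(s) = ε √(k₂ - k₁) / (2 (1 + k₁ s²) √(1 + k₂ s²))`, where `ε = ± 1`. -/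
def alphaBetaTau (ε k₁ k₂ s : ℝ) : ℝ :=
  ε * √(k₂ - k₁) / (2 * (1 + k₁ * s ^ 2) * √(1 + k₂ * s ^ 2))

/-- `φ(s) = {(1 + k₁ s²)(1 + k₂ s²)}^{1/4} exp (∫₀ˢ τ)`. -/
def alphaBetaPhi (ε k₁ k₂ s : ℝ) : ℝ :=
  ((1 + k₁ * s ^ 2) * (1 + k₂ * s ^ 2)) ^ (1 / 4 : ℝ) *
    Real.exp (∫ t in (0 : ℝ)..s, alphaBetaTau ε k₁ k₂ t)

/-- All the expressions in the formula for `φ(s)` make sense: on the interval between `0` and `s`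
the quantity under the square root in `τ` is positive and the denominator of `τ` does not vanish
(so `τ` is continuous there), and the quantity under the fourth root is nonnegative. -/
def AlphaBetaPhiDefinedAt (k₁ k₂ s : ℝ) : Prop :=
  (∀ t ∈ Set.uIcc 0 s, 1 + k₁ * t ^ 2 ≠ 0 ∧ 0 < 1 + k₂ * t ^ 2) ∧
    0 ≤ (1 + k₁ * s ^ 2) * (1 + k₂ * s ^ 2)

section Finsler

variable {E : Type*} [NormedAddCommGroup E] [NormedSpace ℝ E]
  {H : Type*} [TopologicalSpace H] (I : ModelWithCorners ℝ E H)
  {M : Type*} [TopologicalSpace M] [ChartedSpace H M]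

/-- The fundamental tensor of a function `F` on the tangent bundle:
`g_y(u, v) = ½ ∂²/∂s∂t [F²(y + s u + t v)]` at `s = t = 0`, i.e. `g_ij = ½ [F²]_{y^i y^j}`. -/
def fundamentalTensor (F : (x : M) → TangentSpace I x → ℝ) (x : M)
    (y u v : TangentSpace I x) : ℝ :=
  (1 / 2) * deriv (fun s : ℝ => deriv (fun t : ℝ => F x (y + s • u + t • v) ^ 2) 0) 0

/-- `F` is a positive definite Finsler metric on `TM ∖ 0`. -/
structure IsPositiveDefiniteFinsler [IsManifold I 1 M]
    (F : (x : M) → TangentSpace I x → ℝ) : Prop where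
  smooth : ContMDiffOn I.tangent 𝓘(ℝ) ∞ (fun p : TangentBundle I M => F p.1 p.2)
    {p : TangentBundle I M | p.2 ≠ 0}
  pos : ∀ (x : M) (y : TangentSpace I x), y ≠ 0 → 0 < F x y
  homogeneous : ∀ (x : M) (y : TangentSpace I x) (c : ℝ), 0 < c → F x (c • y) = c * F x y
  posDef : ∀ (x : M) (y : TangentSpace I x), y ≠ 0 →
    ∀ u : TangentSpace I x, u ≠ 0 → 0 < fundamentalTensor I F x y u u

end Finsler

section AlphaBeta

variable {E : Type*} [NormedAddCommGroup E] [NormedSpace ℝ E]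
  {H : Type*} [TopologicalSpace H] (I : ModelWithCorners ℝ E H)
  {M : Type*} [TopologicalSpace M] [ChartedSpace H M]
  [Bundle.RiemannianBundle (fun x : M => TangentSpace I x)]

/-- The `(α, β)`-metric `F = α φ(β / α)`, where `α(x, y) = ‖y‖` is the norm of the Riemannian
metric on `M` and `φ` is a function of one real variable. -/
def alphaBetaMetric (φ : ℝ → ℝ) (β : (x : M) → TangentSpace I x →L[ℝ] ℝ) (x : M)
    (y : TangentSpace I x) : ℝ :=
  ‖y‖ * φ (β x y / ‖y‖)

end AlphaBeta

end

/-!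
Put `c = ε √(k₂ - k₁)`. Since `(√(1 + k₂ s²) + c s) (√(1 + k₂ s²) - c s) = 1 + k₁ s²`, the integral
of `τ` is elementary and `φ(s)² = √(1 + k₂ s²) (√(1 + k₂ s²) + c s)` wherever `1 + k₁ s² > 0`. Hence
`F² = γ (γ + cβ)` with `γ = √(α² + k₂ β²)`, and `γ² - (cβ)² = α² + k₁ β²` gives
`F² = (γ + cβ)² / 2 + (α² + k₁ β²) / 2`: up to the factor `1 / 2`, the square of a Randers metric
plus a quadratic form that is positive definite when `1 + k₁ b² > 0`. Conversely, if `1 + k₁ b² ≤ 0`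
at a point `x`, then by connectedness of `T_x M ∖ 0` some `y ≠ 0` has `1 + k₁ (β(y) / α(y))² = 0`,
and `F(y) = 0`.
-/

theorem one_add_mul_sq_pos_of_sq_le {k s b : ℝ} (hb : 0 < 1 + k * b ^ 2) (hs : s ^ 2 ≤ b ^ 2) :
    0 < 1 + k * s ^ 2 := by
  rcases le_total 0 k with hk | hk
  · positivity
  · linarith [mul_le_mul_of_nonpos_left hs hk]

theorem one_add_mul_sq_pos_of_le {k₁ k₂ s : ℝ} (hk : k₁ ≤ k₂) (hs : 0 < 1 + k₁ * s ^ 2) :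
    0 < 1 + k₂ * s ^ 2 := by
  linarith [mul_le_mul_of_nonneg_right hk (sq_nonneg s)]

theorem exists_abs_le_one_add_mul_sq_eq_zero {k b : ℝ} (hb : 1 + k * b ^ 2 ≤ 0) :
    ∃ s, |s| ≤ |b| ∧ 1 + k * s ^ 2 = 0 := by
  obtain ⟨s, hs, hs'⟩ := intermediate_value_uIcc (a := b) (b := 0)
    (f := fun s : ℝ => 1 + k * s ^ 2) (by fun_prop) (Set.mem_uIcc_of_le hb (by simp))
  exact ⟨s, by simpa using Set.abs_sub_right_of_mem_uIcc hs, hs'⟩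

theorem alphaBetaPhiDefinedAt_of_pos {k₁ k₂ s : ℝ} (hk : k₁ ≤ k₂) (hs : 0 < 1 + k₁ * s ^ 2) :
    AlphaBetaPhiDefinedAt k₁ k₂ s := by
  refine ⟨fun t ht => ?_, (mul_pos hs (one_add_mul_sq_pos_of_le hk hs)).le⟩
  have hts : t ^ 2 ≤ s ^ 2 := sq_le_sq.2 (by simpa using Set.abs_sub_left_of_mem_uIcc ht)
  have ht₁ := one_add_mul_sq_pos_of_sq_le hs hts
  exact ⟨ht₁.ne', one_add_mul_sq_pos_of_le hk ht₁⟩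

section ClosedForm

variable {ε c k₁ k₂ s : ℝ}

theorem sq_mul_sqrt_sub (hε : ε = 1 ∨ ε = -1) (hk : k₁ ≤ k₂) :
    (ε * √(k₂ - k₁)) ^ 2 = k₂ - k₁ := by
  rw [mul_pow, sq_eq_one_iff.2 hε, one_mul, Real.sq_sqrt (sub_nonneg.2 hk)]

theorem abs_mul_lt_sqrt_one_add_mul_sq (hc : c ^ 2 = k₂ - k₁) (hs : 0 < 1 + k₁ * s ^ 2) :
    |c * s| < √(1 + k₂ * s ^ 2) := by
  rw [Real.lt_sqrt (abs_nonneg _), sq_abs, mul_pow, hc]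
  linarith

theorem sqrt_add_mul_sqrt_sub (hc : c ^ 2 = k₂ - k₁) (hB : 0 ≤ 1 + k₂ * s ^ 2) :
    (√(1 + k₂ * s ^ 2) + c * s) * (√(1 + k₂ * s ^ 2) - c * s) = 1 + k₁ * s ^ 2 := by
  linear_combination Real.sq_sqrt hB - s ^ 2 * hc

theorem hasDerivAt_log_sqrt_add (hB : 0 < 1 + k₂ * s ^ 2) (hP : √(1 + k₂ * s ^ 2) + c * s ≠ 0) :
    HasDerivAt (fun s => Real.log (√(1 + k₂ * s ^ 2) + c * s))
      ((k₂ * s / √(1 + k₂ * s ^ 2) + c) / (√(1 + k₂ * s ^ 2) + c * s)) s := by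
  have hpoly : HasDerivAt (fun s : ℝ => 1 + k₂ * s ^ 2) (2 * (k₂ * s)) s :=
    (((hasDerivAt_pow 2 s).const_mul k₂).const_add 1).congr_deriv (by push_cast; ring)
  refine ((hpoly.sqrt hB.ne').add ((hasDerivAt_id' s).const_mul c)).log hP |>.congr_deriv ?_
  rw [mul_div_mul_left _ _ two_ne_zero, mul_one]
  rfl

theorem hasDerivAt_log_sub_log_div_four (hc : c ^ 2 = k₂ - k₁) (hs : 0 < 1 + k₁ * s ^ 2) :
    HasDerivAt (fun s => (Real.log (√(1 + k₂ * s ^ 2) + c * s) -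
      Real.log (√(1 + k₂ * s ^ 2) - c * s)) / 4)
      (c / (2 * (1 + k₁ * s ^ 2) * √(1 + k₂ * s ^ 2))) s := by
  have hB := one_add_mul_sq_pos_of_le (sub_nonneg.1 (hc ▸ sq_nonneg c)) hs
  have hcs := abs_lt.1 (abs_mul_lt_sqrt_one_add_mul_sq hc hs)
  have hP : √(1 + k₂ * s ^ 2) + c * s ≠ 0 := by linarith [hcs.1]
  have hQ : √(1 + k₂ * s ^ 2) - c * s ≠ 0 := by linarith [hcs.2]
  have hderivQ := hasDerivAt_log_sqrt_add (c := -c) hB (by simpa [sub_eq_add_neg] using hQ)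
  simp only [neg_mul, ← sub_eq_add_neg] at hderivQ
  refine (((hasDerivAt_log_sqrt_add hB hP).sub hderivQ).div_const 4).congr_deriv ?_
  have hr : √(1 + k₂ * s ^ 2) ^ 2 = 1 + k₂ * s ^ 2 := Real.sq_sqrt hB.le
  have hr₀ : √(1 + k₂ * s ^ 2) ≠ 0 := (Real.sqrt_pos.2 hB).ne'
  rw [← sqrt_add_mul_sqrt_sub hc hB.le]
  generalize √(1 + k₂ * s ^ 2) = r at *
  generalize hP' : r + c * s = P at *
  generalize hQ' : r - c * s = Q at *
  field_simp
  subst hP' hQ'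
  linear_combination 4 * c * hr

theorem integral_alphaBetaTau (hε : ε = 1 ∨ ε = -1) (hk : k₁ ≤ k₂) (hs : 0 < 1 + k₁ * s ^ 2) :
    ∫ t in (0 : ℝ)..s, alphaBetaTau ε k₁ k₂ t =
      (Real.log (√(1 + k₂ * s ^ 2) + ε * √(k₂ - k₁) * s) -
        Real.log (√(1 + k₂ * s ^ 2) - ε * √(k₂ - k₁) * s)) / 4 := by
  have hpos : ∀ t ∈ Set.uIcc 0 s, 0 < 1 + k₁ * t ^ 2 := fun t ht =>
    one_add_mul_sq_pos_of_sq_le hs (sq_le_sq.2 (by simpa using Set.abs_sub_left_of_mem_uIcc ht))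
  have hcont : ContinuousOn (alphaBetaTau ε k₁ k₂) (Set.uIcc 0 s) := by
    refine continuousOn_const.div (by fun_prop) fun t ht => ?_
    have hA := hpos t ht
    have hB := one_add_mul_sq_pos_of_le hk hA
    positivity
  have hderiv : ∀ t ∈ Set.uIcc 0 s, HasDerivAt _ (alphaBetaTau ε k₁ k₂ t) t := fun t ht =>
    hasDerivAt_log_sub_log_div_four (sq_mul_sqrt_sub hε hk) (hpos t ht)
  exact (intervalIntegral.integral_eq_sub_of_hasDerivAt hderiv hcont.intervalIntegrable).trans
    (by simp)

theorem alphaBetaPhi_eq_sqrt (hε : ε = 1 ∨ ε = -1) (hk : k₁ ≤ k₂) (hs : 0 < 1 + k₁ * s ^ 2) :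
    alphaBetaPhi ε k₁ k₂ s =
      √(√(1 + k₂ * s ^ 2) * (√(1 + k₂ * s ^ 2) + ε * √(k₂ - k₁) * s)) := by
  have hc := sq_mul_sqrt_sub hε hk
  have hB := one_add_mul_sq_pos_of_le hk hs
  have hcs := abs_lt.1 (abs_mul_lt_sqrt_one_add_mul_sq hc hs)
  have hprod := sqrt_add_mul_sqrt_sub hc hB.le
  rw [alphaBetaPhi, integral_alphaBetaTau hε hk hs, ← hprod]
  have hr := Real.sq_sqrt hB.le
  have hr₀ := Real.sqrt_pos.2 hB
  rw [← hr, Real.sqrt_sq hr₀.le]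
  generalize ε * √(k₂ - k₁) * s = x at *
  generalize √(1 + k₂ * s ^ 2) = r at *
  have hP : 0 < r + x := by linarith
  have hQ : 0 < r - x := by linarith
  rw [Real.rpow_def_of_pos (by positivity), ← Real.exp_add, Real.sqrt_eq_rpow,
    Real.rpow_def_of_pos (by positivity), Real.log_mul (by positivity) (by positivity),
    Real.log_mul hP.ne' hQ.ne', Real.log_mul hr₀.ne' hP.ne', Real.log_pow]
  ring_nf

theorem sqrt_mul_sqrt_add_pos (hc : c ^ 2 = k₂ - k₁) (hs : 0 < 1 + k₁ * s ^ 2) :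
    0 < √(1 + k₂ * s ^ 2) * (√(1 + k₂ * s ^ 2) + c * s) :=
  mul_pos (Real.sqrt_pos.2 (one_add_mul_sq_pos_of_le (sub_nonneg.1 (hc ▸ sq_nonneg c)) hs))
    (neg_lt_iff_pos_add'.1 (abs_lt.1 (abs_mul_lt_sqrt_one_add_mul_sq hc hs)).1)

theorem alphaBetaPhi_pos (ε : ℝ) (hk : k₁ ≤ k₂) (hs : 0 < 1 + k₁ * s ^ 2) :
    0 < alphaBetaPhi ε k₁ k₂ s :=
  mul_pos (Real.rpow_pos_of_pos (mul_pos hs (one_add_mul_sq_pos_of_le hk hs)) _) (Real.exp_pos _)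

theorem alphaBetaPhi_eq_zero (ε k₂ : ℝ) (hs : 1 + k₁ * s ^ 2 = 0) : alphaBetaPhi ε k₁ k₂ s = 0 := by
  simp [alphaBetaPhi, hs]

theorem alphaBetaPhi_sq (hε : ε = 1 ∨ ε = -1) (hk : k₁ ≤ k₂) (hs : 0 < 1 + k₁ * s ^ 2) :
    alphaBetaPhi ε k₁ k₂ s ^ 2 =
      √(1 + k₂ * s ^ 2) * (√(1 + k₂ * s ^ 2) + ε * √(k₂ - k₁) * s) := by
  rw [alphaBetaPhi_eq_sqrt hε hk hs,
    Real.sq_sqrt (sqrt_mul_sqrt_add_pos (sq_mul_sqrt_sub hε hk) hs).le]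

theorem contDiffAt_alphaBetaPhi (hε : ε = 1 ∨ ε = -1) (hk : k₁ ≤ k₂) (hs : 0 < 1 + k₁ * s ^ 2) :
    ContDiffAt ℝ ∞ (alphaBetaPhi ε k₁ k₂) s := by
  have hev : ∀ᶠ t in nhds s, 0 < 1 + k₁ * t ^ 2 :=
    (isOpen_lt continuous_const (by fun_prop)).mem_nhds hs
  have hB : ContDiffAt ℝ ∞ (fun t : ℝ => √(1 + k₂ * t ^ 2)) s :=
    ContDiffAt.sqrt (by fun_prop) (one_add_mul_sq_pos_of_le hk hs).ne'
  refine ContDiffAt.congr_of_eventuallyEq ?_ (hev.mono fun t ht => alphaBetaPhi_eq_sqrt hε hk ht)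
  exact (hB.mul (hB.add (by fun_prop))).sqrt
    (sqrt_mul_sqrt_add_pos (sq_mul_sqrt_sub hε hk) hs).ne'

end ClosedForm

section SquareRootMetric

theorem hasDerivAt_div_two_mul_sqrt {q q' : ℝ → ℝ} {q'' t : ℝ} (hq₀ : 0 < q t)
    (hq : HasDerivAt q (q' t) t) (hq' : HasDerivAt q' q'' t) :
    HasDerivAt (fun t => q' t / (2 * √(q t)))
      ((2 * q'' * q t - q' t ^ 2) / (4 * q t * √(q t))) t := by
  have hr₀ := Real.sqrt_pos.2 hq₀
  refine (hq'.div ((hq.sqrt hq₀.ne').const_mul 2) (by positivity)).congr_deriv ?_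
  have hr := Real.sq_sqrt hq₀.le
  generalize √(q t) = r at *
  rw [← hr]
  field_simp
  ring

-- With `f = √q`, differentiate `f (f + ℓ) = (f + ℓ)² / 2 + (q - ℓ²) / 2` twice.
theorem deriv_deriv_sqrt_mul_sqrt_add {q q' ℓ : ℝ → ℝ} {q'' ℓ' t : ℝ} (hq₀ : 0 < q t)
    (hq : ∀ t, HasDerivAt q (q' t) t) (hq' : HasDerivAt q' q'' t)
    (hℓ : ∀ t, HasDerivAt ℓ ℓ' t) :
    deriv (deriv fun t => √(q t) * (√(q t) + ℓ t)) t =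
      (q' t / (2 * √(q t)) + ℓ') ^ 2 +
        (√(q t) + ℓ t) * ((2 * q'' * q t - q' t ^ 2) / (4 * q t * √(q t))) +
        (q'' / 2 - ℓ' ^ 2) := by
  have hev : ∀ᶠ s in nhds t, 0 < q s := (hq t).continuousAt.eventually_const_lt hq₀
  have hderiv : deriv (fun t => √(q t) * (√(q t) + ℓ t)) =ᶠ[nhds t] fun t =>
      q' t + (q' t / (2 * √(q t)) * ℓ t + √(q t) * ℓ') := by
    filter_upwards [hev] with s hs
    have hsqrt := (hq s).sqrt hs.ne'
    refine ((hsqrt.mul (hsqrt.add (hℓ s))).congr_deriv ?_).deriv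
    have := Real.sqrt_pos.2 hs
    simp only [Pi.add_apply]
    field_simp
    ring
  have hsqrt := (hq t).sqrt hq₀.ne'
  have hsqrt' := hasDerivAt_div_two_mul_sqrt hq₀ (hq t) hq'
  rw [hderiv.deriv_eq]
  refine ((hq'.add ((hsqrt'.mul (hℓ t)).add (hsqrt.mul_const ℓ'))).congr_deriv ?_).deriv
  have hr₀ := Real.sqrt_pos.2 hq₀
  have hr := Real.sq_sqrt hq₀.le
  generalize √(q t) = r at *
  rw [← hr]
  field_simp
  ring

theorem quadraticForm_add_smul {R V : Type*} [CommRing R] [AddCommGroup V] [Module R V]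
    (Q : QuadraticForm R V) (y u : V) (t : R) :
    Q (y + t • u) = Q u * (t * t) + QuadraticMap.polar Q y u * t + Q y := by
  rw [QuadraticMap.map_add Q, QuadraticMap.map_smul, QuadraticMap.polar_smul_right, smul_eq_mul,
    smul_eq_mul]
  ring

theorem sq_polar_le_four_mul {K V : Type*} [Field K] [LinearOrder K] [IsStrictOrderedRing K]
    [AddCommGroup V] [Module K V] {Q : QuadraticForm K V} (hQ : ∀ y, 0 ≤ Q y) (y u : V) :
    QuadraticMap.polar Q y u ^ 2 ≤ 4 * Q u * Q y :=
  sub_nonpos.1 (discrim_le_zero fun t => quadraticForm_add_smul Q y u t ▸ hQ _)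

theorem deriv_deriv_sqrt_mul_sqrt_add_pos {V : Type*} [AddCommGroup V] [Module ℝ V]
    {Q : QuadraticForm ℝ V} {ℓ : V →ₗ[ℝ] ℝ} (hQℓ : ∀ y ≠ 0, ℓ y ^ 2 < Q y) {y u : V}
    (hy : y ≠ 0) (hu : u ≠ 0) :
    0 < deriv (deriv fun t : ℝ => √(Q (y + t • u)) * (√(Q (y + t • u)) + ℓ (y + t • u))) 0 := by
  have hQ : ∀ z ≠ 0, 0 < Q z := fun z hz => (sq_nonneg _).trans_lt (hQℓ z hz)
  have hCS := sq_polar_le_four_mul (Q := Q)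
    (fun z => (eq_or_ne z 0).elim (fun h => by simp [h]) fun h => (hQ z h).le) y u
  have hq : ∀ t, HasDerivAt (fun t : ℝ => Q (y + t • u))
      (2 * Q u * t + QuadraticMap.polar Q y u) t := fun t => by
    simp only [quadraticForm_add_smul]
    exact ((((hasDerivAt_id' t).mul (hasDerivAt_id' t)).const_mul (Q u)).add
      ((hasDerivAt_id' t).const_mul (QuadraticMap.polar Q y u))).add_const (Q y)
      |>.congr_deriv (by ring)
  have hq' : HasDerivAt (fun t => 2 * Q u * t + QuadraticMap.polar Q y u) (2 * Q u) 0 :=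
    (((hasDerivAt_id' 0).const_mul (2 * Q u)).add_const _).congr_deriv (mul_one _)
  have hℓ : ∀ t, HasDerivAt (fun t : ℝ => ℓ (y + t • u)) (ℓ u) t := fun t => by
    simp only [map_add, map_smul, smul_eq_mul]
    exact (((hasDerivAt_id' t).mul_const (ℓ u)).const_add (ℓ y)).congr_deriv (one_mul _)
  rw [deriv_deriv_sqrt_mul_sqrt_add (by simpa using hQ y hy) hq hq' hℓ]
  simp only [zero_smul, add_zero, mul_zero, zero_add]
  have hsqrt : 0 < √(Q y) := Real.sqrt_pos.2 (hQ y hy)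
  have hadd : 0 < √(Q y) + ℓ y := neg_lt_iff_pos_add'.1
    (abs_lt.1 ((Real.lt_sqrt (abs_nonneg _)).2 ((sq_abs (ℓ y)).trans_lt (hQℓ y hy)))).1
  have hsqrt'' : 0 ≤ (2 * (2 * Q u) * Q y - QuadraticMap.polar Q y u ^ 2) / (4 * Q y * √(Q y)) :=
    div_nonneg (by linarith) (mul_nonneg (mul_nonneg zero_le_four (hQ y hy).le) hsqrt.le)
  have hform : 0 < 2 * Q u / 2 - ℓ u ^ 2 := by linarith [hQℓ u hu]
  positivity

end SquareRootMetric

section NormedSpace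

variable {V : Type*} [SeminormedAddCommGroup V] [NormedSpace ℝ V]

theorem sq_apply_div_norm_le (β : V →L[ℝ] ℝ) (y : V) : (β y / ‖y‖) ^ 2 ≤ ‖β‖ ^ 2 := by
  rw [sq_le_sq, abs_div, abs_norm, abs_norm]
  exact β.ratio_le_opNorm y

theorem one_add_mul_sq_apply_div_norm_pos {k : ℝ} {β : V →L[ℝ] ℝ} (hβ : 0 < 1 + k * ‖β‖ ^ 2)
    (y : V) : 0 < 1 + k * (β y / ‖y‖) ^ 2 :=
  one_add_mul_sq_pos_of_sq_le hβ (sq_apply_div_norm_le β y)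

end NormedSpace

section InnerProductSpace

variable {V : Type*} [NormedAddCommGroup V] [InnerProductSpace ℝ V]

/-- The quadratic form `α² + k β²` on a single tangent space `V`, where `α` is the norm of `V`. -/
noncomputable def normSqAddSq (k : ℝ) (β : V →L[ℝ] ℝ) : QuadraticForm ℝ V :=
  LinearMap.BilinMap.toQuadraticMap (innerₗ V) +
    k • QuadraticMap.linMulLin β.toLinearMap β.toLinearMap

theorem normSqAddSq_apply (k : ℝ) (β : V →L[ℝ] ℝ) (y : V) :
    normSqAddSq k β y = ‖y‖ ^ 2 + k * β y ^ 2 := by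
  simp [normSqAddSq, sq]

theorem normSqAddSq_eq_norm_sq_mul (k : ℝ) (β : V →L[ℝ] ℝ) (y : V) :
    normSqAddSq k β y = ‖y‖ ^ 2 * (1 + k * (β y / ‖y‖) ^ 2) := by
  rcases eq_or_ne y 0 with rfl | hy
  · simp
  rw [normSqAddSq_apply]
  field_simp [norm_ne_zero_iff.2 hy]

theorem sqrt_normSqAddSq (k : ℝ) (β : V →L[ℝ] ℝ) (y : V) :
    √(normSqAddSq k β y) = ‖y‖ * √(1 + k * (β y / ‖y‖) ^ 2) := by
  rw [normSqAddSq_eq_norm_sq_mul, Real.sqrt_mul (sq_nonneg _), Real.sqrt_sq (norm_nonneg y)]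

theorem normSqAddSq_pos {k : ℝ} {β : V →L[ℝ] ℝ} (hβ : 0 < 1 + k * ‖β‖ ^ 2) {y : V} (hy : y ≠ 0) :
    0 < normSqAddSq k β y := by
  rw [normSqAddSq_eq_norm_sq_mul]
  exact mul_pos (pow_pos (norm_pos_iff.2 hy) 2) (one_add_mul_sq_apply_div_norm_pos hβ y)

variable {ε k₁ k₂ : ℝ}

theorem sq_norm_mul_alphaBetaPhi (hε : ε = 1 ∨ ε = -1) (hk : k₁ ≤ k₂) {β : V →L[ℝ] ℝ}
    (hβ : 0 < 1 + k₁ * ‖β‖ ^ 2) (y : V) :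
    (‖y‖ * alphaBetaPhi ε k₁ k₂ (β y / ‖y‖)) ^ 2 =
      √(normSqAddSq k₂ β y) * (√(normSqAddSq k₂ β y) + ε * √(k₂ - k₁) * β y) := by
  rcases eq_or_ne y 0 with rfl | hy
  · simp
  rw [mul_pow, alphaBetaPhi_sq hε hk (one_add_mul_sq_apply_div_norm_pos hβ y), sqrt_normSqAddSq]
  field_simp [norm_ne_zero_iff.2 hy]

theorem exists_ne_zero_apply_eq_norm_mul_norm [Nontrivial V] [CompleteSpace V] (β : V →L[ℝ] ℝ) :
    ∃ v ≠ 0, β v = ‖β‖ * ‖v‖ := by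
  obtain ⟨v, rfl⟩ := (InnerProductSpace.toDual ℝ V).surjective β
  rcases eq_or_ne v 0 with rfl | hv
  · simpa using exists_ne (0 : V)
  · exact ⟨v, hv, by simp [← sq]⟩

theorem exists_ne_zero_apply_div_norm_eq [CompleteSpace V] (hV : 1 < Module.rank ℝ V)
    (β : V →L[ℝ] ℝ) {s : ℝ} (hs : |s| ≤ ‖β‖) : ∃ y ≠ 0, β y / ‖y‖ = s := by
  have : Nontrivial V := rank_pos_iff_nontrivial.1 (zero_lt_one.trans hV)
  obtain ⟨v, hv, hβv⟩ := exists_ne_zero_apply_eq_norm_mul_norm β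
  have hmax : β v / ‖v‖ = ‖β‖ := (div_eq_iff (norm_ne_zero_iff.2 hv)).2 hβv
  have hcont : ContinuousOn (fun y : V => β y / ‖y‖) {0}ᶜ :=
    β.continuous.continuousOn.div continuous_norm.continuousOn fun y hy => norm_ne_zero_iff.2 hy
  refine (isConnected_compl_singleton_of_one_lt_rank hV (0 : V)).isPreconnected.intermediate_value
    (a := -v) (b := v) (neg_ne_zero.2 hv) hv hcont ?_
  rw [map_neg, norm_neg, neg_div, hmax]
  exact abs_le.1 hs

theorem exists_ne_zero_alphaBetaPhi_eq_zero [CompleteSpace V] (hV : 1 < Module.rank ℝ V)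
    (ε k₂ : ℝ) {β : V →L[ℝ] ℝ} (hβ : 1 + k₁ * ‖β‖ ^ 2 ≤ 0) :
    ∃ y ≠ 0, alphaBetaPhi ε k₁ k₂ (β y / ‖y‖) = 0 := by
  obtain ⟨s, hs, hs₀⟩ := exists_abs_le_one_add_mul_sq_eq_zero hβ
  obtain ⟨y, hy, rfl⟩ := exists_ne_zero_apply_div_norm_eq hV β (hs.trans_eq (abs_norm β))
  exact ⟨y, hy, alphaBetaPhi_eq_zero ε k₂ hs₀⟩

end InnerProductSpace

section VectorBundle

open Bundle

variable {E : Type*} [NormedAddCommGroup E] [NormedSpace ℝ E]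
  {H : Type*} [TopologicalSpace H] {I : ModelWithCorners ℝ E H}
  {M : Type*} [TopologicalSpace M] [ChartedSpace H M]
  {F : Type*} [NormedAddCommGroup F] [NormedSpace ℝ F]
  {W : M → Type*} [TopologicalSpace (TotalSpace F W)] {n : WithTop ℕ∞}

section LinearForm

variable [∀ x, AddCommGroup (W x)] [∀ x, Module ℝ (W x)] [∀ x, TopologicalSpace (W x)]
  [FiberBundle F W] [VectorBundle ℝ F W]

theorem contMDiff_linearForm_totalSpace {β : (x : M) → W x →L[ℝ] ℝ}
    (hβ : ContMDiff I (I.prod 𝓘(ℝ, F →L[ℝ] ℝ)) n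
      (fun x => TotalSpace.mk' (F →L[ℝ] ℝ) (E := fun x => W x →L[ℝ] ℝ) x (β x))) :
    ContMDiff (I.prod 𝓘(ℝ, F)) 𝓘(ℝ) n (fun p : TotalSpace F W => β p.1 p.2) := by
  intro p
  have happly : ContMDiffAt (I.prod 𝓘(ℝ, F)) (I.prod 𝓘(ℝ)) n (fun p : TotalSpace F W =>
      TotalSpace.mk' ℝ (E := Trivial M ℝ) p.1 (β p.1 p.2)) p :=
    ContMDiffAt.clm_bundle_apply (F₁ := F) (F₂ := ℝ) (E₁ := W) (E₂ := Trivial M ℝ)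
      (ϕ := fun p : TotalSpace F W => β p.1)
      (hβ.contMDiffAt.comp p (contMDiff_proj W).contMDiffAt) contMDiffAt_id
  exact (contMDiffAt_totalSpace.1 happly).2

end LinearForm

theorem contMDiffAt_norm_totalSpace [∀ x, NormedAddCommGroup (W x)]
    [∀ x, InnerProductSpace ℝ (W x)] [FiberBundle F W] [VectorBundle ℝ F W]
    [IsContMDiffRiemannianBundle I n F W] {p : TotalSpace F W} (hp : p.2 ≠ 0) :
    ContMDiffAt (I.prod 𝓘(ℝ, F)) 𝓘(ℝ) n (fun p : TotalSpace F W => ‖p.2‖) p := by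
  have hinner : ContMDiffAt (I.prod 𝓘(ℝ, F)) 𝓘(ℝ) n
      (fun p : TotalSpace F W => inner ℝ p.2 p.2) p :=
    ContMDiffAt.inner_bundle contMDiffAt_id contMDiffAt_id
  simp only [norm_eq_sqrt_real_inner]
  exact (Real.contDiffAt_sqrt (inner_self_ne_zero.2 hp)).contMDiffAt.comp p hinner

end VectorBundle

section Manifold

variable {E : Type*} [NormedAddCommGroup E] [NormedSpace ℝ E]
  {H : Type*} [TopologicalSpace H] {I : ModelWithCorners ℝ E H}
  {M : Type*} [TopologicalSpace M] [ChartedSpace H M]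

theorem fundamentalTensor_self (F : (x : M) → TangentSpace I x → ℝ) (x : M)
    (y u : TangentSpace I x) :
    fundamentalTensor I F x y u u = 1 / 2 * deriv (deriv fun t : ℝ => F x (y + t • u) ^ 2) 0 := by
  have hderiv (s : ℝ) : deriv (fun t : ℝ => F x (y + s • u + t • u) ^ 2) 0 =
      deriv (fun t : ℝ => F x (y + t • u) ^ 2) s := by
    simp only [add_assoc, ← add_smul]
    rw [deriv_comp_const_add (f := fun t : ℝ => F x (y + t • u) ^ 2), add_zero]
  simp only [fundamentalTensor, hderiv]

variable [Bundle.RiemannianBundle (fun x : M => TangentSpace I x)]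

theorem alphaBetaMetric_smul (φ : ℝ → ℝ) (β : (x : M) → TangentSpace I x →L[ℝ] ℝ) (x : M)
    (y : TangentSpace I x) {c : ℝ} (hc : 0 < c) :
    alphaBetaMetric I φ β x (c • y) = c * alphaBetaMetric I φ β x y := by
  rw [alphaBetaMetric, alphaBetaMetric, norm_smul, Real.norm_of_nonneg hc.le, map_smul, smul_eq_mul,
    mul_div_mul_left _ _ hc.ne', mul_assoc]

-- The Riemannian norm induces the topology of `E` on the fibre, but not its norm.
theorem completeSpace_tangentSpace [CompleteSpace E] (x : M) :
    CompleteSpace (TangentSpace I x) := by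
  let e : E ≃L[ℝ] TangentSpace I x := ContinuousLinearEquiv.refl ℝ E
  exact (completeSpace_congr (e := e.toEquiv) e.isUniformEmbedding).1 inferInstance

theorem fundamentalTensor_alphaBetaPhi_pos {ε k₁ k₂ : ℝ} (hε : ε = 1 ∨ ε = -1) (hk : k₁ ≤ k₂)
    {β : (x : M) → TangentSpace I x →L[ℝ] ℝ} {x : M} (hb : 0 < 1 + k₁ * ‖β x‖ ^ 2)
    {y u : TangentSpace I x} (hy : y ≠ 0) (hu : u ≠ 0) :
    0 < fundamentalTensor I (alphaBetaMetric I (alphaBetaPhi ε k₁ k₂) β) x y u u := by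
  rw [fundamentalTensor_self]
  simp only [alphaBetaMetric, sq_norm_mul_alphaBetaPhi hε hk hb]
  refine mul_pos one_half_pos (deriv_deriv_sqrt_mul_sqrt_add_pos
    (ℓ := (ε * √(k₂ - k₁)) • (β x).toLinearMap) (fun z hz => ?_) hy hu)
  have hpos := normSqAddSq_pos hb hz
  rw [normSqAddSq_apply] at hpos ⊢
  simp only [LinearMap.smul_apply, ContinuousLinearMap.coe_coe, smul_eq_mul, mul_pow,
    sq_mul_sqrt_sub hε hk]
  linarith

theorem IsPositiveDefiniteFinsler.one_add_mul_sq_norm_pos [IsManifold I 1 M] [CompleteSpace E]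
    (hE : 1 < Module.rank ℝ E) {β : (x : M) → TangentSpace I x →L[ℝ] ℝ} {ε k₁ k₂ : ℝ}
    (hF : IsPositiveDefiniteFinsler I (alphaBetaMetric I (alphaBetaPhi ε k₁ k₂) β)) (x : M) :
    0 < 1 + k₁ * ‖β x‖ ^ 2 := by
  by_contra! hb
  have := completeSpace_tangentSpace (I := I) x
  obtain ⟨y, hy, hφ⟩ := exists_ne_zero_alphaBetaPhi_eq_zero (V := TangentSpace I x) hE ε k₂ hb
  exact (hF.pos x y hy).ne' (by rw [alphaBetaMetric, hφ, mul_zero])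

variable [IsManifold I ∞ M]
  [IsContMDiffRiemannianBundle I ∞ E (fun x : M => TangentSpace I x)]

theorem contMDiffAt_alphaBetaMetric {φ : ℝ → ℝ} {β : (x : M) → TangentSpace I x →L[ℝ] ℝ}
    (hβ : ContMDiff I (I.prod 𝓘(ℝ, E →L[ℝ] ℝ)) ∞
      (fun x => Bundle.TotalSpace.mk' (E →L[ℝ] ℝ)
        (E := fun x : M => TangentSpace I x →L[ℝ] ℝ) x (β x)))
    {p : TangentBundle I M} (hp : p.2 ≠ 0) (hφ : ContDiffAt ℝ ∞ φ (β p.1 p.2 / ‖p.2‖)) :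
    ContMDiffAt I.tangent 𝓘(ℝ) ∞
      (fun p : TangentBundle I M => alphaBetaMetric I φ β p.1 p.2) p := by
  have hα : ContMDiffAt I.tangent 𝓘(ℝ) ∞ (fun p : TangentBundle I M => ‖p.2‖) p :=
    contMDiffAt_norm_totalSpace hp
  have hs := ((contMDiff_linearForm_totalSpace hβ).contMDiffAt (x := p)).div₀ hα
    (norm_ne_zero_iff.2 hp)
  exact hα.mul (hφ.contMDiffAt.comp p hs)

theorem isPositiveDefiniteFinsler_alphaBetaPhi {β : (x : M) → TangentSpace I x →L[ℝ] ℝ}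
    (hβ : ContMDiff I (I.prod 𝓘(ℝ, E →L[ℝ] ℝ)) ∞
      (fun x => Bundle.TotalSpace.mk' (E →L[ℝ] ℝ)
        (E := fun x : M => TangentSpace I x →L[ℝ] ℝ) x (β x)))
    {ε k₁ k₂ : ℝ} (hε : ε = 1 ∨ ε = -1) (hk : k₁ ≤ k₂)
    (hb : ∀ x : M, 0 < 1 + k₁ * ‖β x‖ ^ 2) :
    IsPositiveDefiniteFinsler I (alphaBetaMetric I (alphaBetaPhi ε k₁ k₂) β) where
  smooth p hp := (contMDiffAt_alphaBetaMetric hβ hp (contDiffAt_alphaBetaPhi hε hk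
    (one_add_mul_sq_apply_div_norm_pos (hb p.1) p.2))).contMDiffWithinAt
  pos x y hy := mul_pos (norm_pos_iff.2 hy)
    (alphaBetaPhi_pos ε hk (one_add_mul_sq_apply_div_norm_pos (hb x) y))
  homogeneous x y _ hc := alphaBetaMetric_smul _ β x y hc
  posDef x _ hy _ hu := fundamentalTensor_alphaBetaPhi_pos hε hk (hb x) hy hu

end Manifold

theorem lemma3p1_general {E : Type*} [NormedAddCommGroup E] [NormedSpace ℝ E] [CompleteSpace E]
    (hE : 1 < Module.rank ℝ E) {H : Type*} [TopologicalSpace H] (I : ModelWithCorners ℝ E H)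
    {M : Type*} [TopologicalSpace M] [ChartedSpace H M] [IsManifold I ∞ M]
    [Bundle.RiemannianBundle (fun x : M => TangentSpace I x)]
    [IsContMDiffRiemannianBundle I ∞ E (fun x : M => TangentSpace I x)]
    (β : (x : M) → TangentSpace I x →L[ℝ] ℝ)
    (hβ : ContMDiff I (I.prod 𝓘(ℝ, E →L[ℝ] ℝ)) ∞
      (fun x => Bundle.TotalSpace.mk' (E →L[ℝ] ℝ)
        (E := fun x : M => TangentSpace I x →L[ℝ] ℝ) x (β x)))
    (ε k₁ k₂ : ℝ) (hε : ε = 1 ∨ ε = -1) (hk : k₁ ≤ k₂) :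
    (IsPositiveDefiniteFinsler I (alphaBetaMetric I (alphaBetaPhi ε k₁ k₂) β) ↔
      ∀ x : M, 0 < 1 + k₁ * ‖β x‖ ^ 2) ∧
    ((∀ x : M, 0 < 1 + k₁ * ‖β x‖ ^ 2) →
      ∀ (x : M) (y : TangentSpace I x), y ≠ 0 →
        AlphaBetaPhiDefinedAt k₁ k₂ (β x y / ‖y‖)) :=
  ⟨⟨fun hF => hF.one_add_mul_sq_norm_pos hE, isPositiveDefiniteFinsler_alphaBetaPhi hβ hε hk⟩,
    fun hb x y _ =>
      alphaBetaPhiDefinedAt_of_pos hk (one_add_mul_sq_apply_div_norm_pos (hb x) y)⟩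

theorem lemma3p1
    {M : Type*} [TopologicalSpace M] [ChartedSpace (EuclideanSpace ℝ (Fin 2)) M]
    [IsManifold (𝓡 2) ∞ M]
    -- the Riemannian metric `α`
    [Bundle.RiemannianBundle (fun x : M => TangentSpace (𝓡 2) x)]
    [IsContMDiffRiemannianBundle (𝓡 2) ∞ (EuclideanSpace ℝ (Fin 2))
      (fun x : M => TangentSpace (𝓡 2) x)]
    -- the smooth `1`-form `β`
    (β : (x : M) → TangentSpace (𝓡 2) x →L[ℝ] ℝ)
    (hβ : ContMDiff (𝓡 2) ((𝓡 2).prod 𝓘(ℝ, EuclideanSpace ℝ (Fin 2) →L[ℝ] ℝ)) ∞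
      (fun x => Bundle.TotalSpace.mk' (EuclideanSpace ℝ (Fin 2) →L[ℝ] ℝ)
        (E := fun x : M => TangentSpace (𝓡 2) x →L[ℝ] ℝ) x (β x)))
    (ε k₁ k₂ : ℝ) (hε : ε = 1 ∨ ε = -1) (hk : k₁ < k₂) :
    (IsPositiveDefiniteFinsler (𝓡 2) (alphaBetaMetric (𝓡 2) (alphaBetaPhi ε k₁ k₂) β) ↔
      ∀ x : M, 0 < 1 + k₁ * ‖β x‖ ^ 2) ∧
    ((∀ x : M, 0 < 1 + k₁ * ‖β x‖ ^ 2) →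
      ∀ (x : M) (y : TangentSpace (𝓡 2) x), y ≠ 0 →
        AlphaBetaPhiDefinedAt k₁ k₂ (β x y / ‖y‖)) := by
  exact lemma3p1_general (Module.lt_rank_of_lt_finrank (by simp)) (𝓡 2) β hβ ε k₁ k₂ hε hk.le
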